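/- Let $(X,\omega)$ be a compact Kähler manifold of dimension $n$. For a holomorphic line bundle $L\to X$ with a smooth Hermitian metric $h$, let $\alpha_h=-\frac{\sqrt{-1}}{2\pi}\partial\bar\partial\log h\in c_1(L)$ be its first Chern form, let $\lambda_1,\dots,\lambda_n$ be the (real) eigenvalues of $\omega^{-1}\alpha_h$ at a point, and let $\Theta_\omega(\alpha_h)=\sum_{i=1}^n\arctan\lambda_i$ be the Lagrangian phase. The metric $h$ solves the deformed Hermitian-Yang-Mills (dHYM) equation if, for a constant $\hat\theta$, $$\operatorname{Im}\big(e^{-\sqrt{-1}\hat\theta}(\omega+\sqrt{-1}\alpha_h)^n\big)=0,\qquad \operatorname{Re}\big(e^{-\sqrt{-1}\hat\theta}(\omega+\sqrt{-1}\alpha_h)^n\big)>0 .$$ This says that $\Theta_\omega(\alpha_h)=\hat\theta$ modulo $2\pi$; the lifted angle $\hat\theta(L)\in\mathbb R$ of the solution is the real constant with $\Theta_\omega(\alpha_h)=\hat\theta(L)$ on $X$, and the slicing angle of $L$ is $\phi_X(L)=\hat\theta(L)-(n-2)\frac{\pi}{2}$. Lemma. Suppose $L$ and $M$ are holomorphic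 line bundles on $X$ that admit solutions of the dHYM equation, with slicing angles $$0<\phi_X(M)<\phi_X(L)<\pi .$$ Then $\operatorname{Hom}(L,M)=0$, i.e. every holomorphic bundle map $L\to M$ (equivalently, every global holomorphic section of $M\otimes L^\vee$) vanishes identically. -/

import Mathlib

open scoped Manifold ContDiff Bundle Matrix

noncomputable section

namespace DHYM

/-- The model space `ℂⁿ` of an `n`-dimensional complex manifold. -/
abbrev Model (n : ℕ) : Type := EuclideanSpace ℂ (Fin n)

/-- The `j`-th coordinate vector `∂/∂x_j` of `ℂⁿ`; then `I • coordVec j` is `∂/∂y_j`. -/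
def coordVec {n : ℕ} (j : Fin n) : Model n := EuclideanSpace.single j 1

/-! ### Wirtinger derivatives and the complex Hessian on `ℂⁿ` -/

/-- `∂f/∂z_j = (∂f/∂x_j - i ∂f/∂y_j) / 2`. -/
def wirtinger {n : ℕ} (j : Fin n) (f : Model n → ℂ) (z : Model n) : ℂ :=
  (fderiv ℝ f z (coordVec j) - Complex.I * fderiv ℝ f z (Complex.I • coordVec j)) / 2

/-- `∂f/∂z̄_j = (∂f/∂x_j + i ∂f/∂y_j) / 2`. -/
def wirtingerBar {n : ℕ} (j : Fin n) (f : Model n → ℂ) (z : Model n) : ℂ :=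
  (fderiv ℝ f z (coordVec j) + Complex.I * fderiv ℝ f z (Complex.I • coordVec j)) / 2

/-- The coefficients `∂²u/∂z_j∂z̄_k` of `i∂∂̄u = i ∑ (∂²u/∂z_j∂z̄_k) dz_j ∧ dz̄_k`. -/
def complexHessian {n : ℕ} (u : Model n → ℝ) (z : Model n) : Matrix (Fin n) (Fin n) ℂ :=
  Matrix.of fun j k => wirtinger j (wirtingerBar k fun w => (u w : ℂ)) z

/-! ### Kähler forms -/

section Kaehler

variable {n : ℕ} {X : Type*} [TopologicalSpace X] [ChartedSpace (Model n) X]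

/-- A real 2-form on the complex manifold `X` (as a family of alternating forms on the real vector
spaces underlying the tangent spaces), read in the chart around `x₀`. -/
def twoFormInChart (η : ∀ x : X, TangentSpace 𝓘(ℂ, Model n) x [⋀^Fin 2]→L[ℝ] ℝ) (x₀ : X) :
    Model n → Model n [⋀^Fin 2]→L[ℝ] ℝ := fun z =>
  (η ((chartAt (Model n) x₀).symm z)).compContinuousLinearMap
    ((mfderiv 𝓘(ℂ, Model n) 𝓘(ℂ, Model n) (chartAt (Model n) x₀).symm z).restrictScalars ℝ)

variable (n X) in
/-- A Kähler form on the complex manifold `X`: a smooth closed positive real `(1,1)`-form. -/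
structure KaehlerForm where
  form : ∀ x : X, TangentSpace 𝓘(ℂ, Model n) x [⋀^Fin 2]→L[ℝ] ℝ
  smooth : ∀ x₀ : X,
    ContDiffOn ℝ ∞ (twoFormInChart form x₀) (chartAt (Model n) x₀).target
  closed : ∀ x₀ : X, ∀ z ∈ (chartAt (Model n) x₀).target,
    extDeriv (twoFormInChart form x₀) z = 0
  type_one_one : ∀ (x : X) (v w : TangentSpace 𝓘(ℂ, Model n) x),
    form x ![Complex.I • v, Complex.I • w] = form x ![v, w]
  pos : ∀ (x : X) (v : TangentSpace 𝓘(ℂ, Model n) x), v ≠ 0 → 0 < form x ![v, Complex.I • v]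

/-- The coefficients `g_{jk̄}` of `η = i ∑ g_{jk̄} dz_j ∧ dz̄_k` at `x`, for a real `(1,1)`-form `η`,
with respect to the coordinates of the preferred chart at `x` (through which `TangentSpace _ x` is
identified with `ℂⁿ`). -/
def KaehlerForm.coeff (η : KaehlerForm n X) (x : X) : Matrix (Fin n) (Fin n) ℂ :=
  Matrix.of fun j k =>
    let ηx : Model n [⋀^Fin 2]→L[ℝ] ℝ := η.form x
    ((ηx ![coordVec j, Complex.I • coordVec k] : ℂ)
      - Complex.I * (ηx ![coordVec j, coordVec k] : ℂ)) / 2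

end Kaehler

/-! ### Hermitian metrics on holomorphic line bundles -/

section LineBundle

variable {n : ℕ} {X : Type*} [TopologicalSpace X] [ChartedSpace (Model n) X]
  {L : X → Type*} [TopologicalSpace (Bundle.TotalSpace ℂ L)]
  [∀ x, TopologicalSpace (L x)] [∀ x, AddCommGroup (L x)] [∀ x, Module ℂ (L x)]
  [FiberBundle ℂ L]

variable (L) in
/-- The local frame of the line bundle `L` given by its preferred trivialization at `x₀`. It is a
holomorphic frame when `L` is a holomorphic line bundle. -/
def frame (x₀ x : X) : L x := (trivializationAt ℂ L x₀).symm x 1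

variable (n L) in
/-- A smooth Hermitian metric on the line bundle `L`. -/
structure HermitianMetric where
  inner : ∀ x : X, L x →ₗ⋆[ℂ] L x →ₗ[ℂ] ℂ
  conj_symm : ∀ (x : X) (v w : L x), (starRingEnd ℂ) (inner x w v) = inner x v w
  pos : ∀ (x : X) (v : L x), v ≠ 0 → 0 < (inner x v v).re
  smooth : ∀ x₀ : X,
    ContMDiffOn 𝓘(ℝ, Model n) 𝓘(ℝ, ℝ) ∞
      (fun x => (inner x (frame L x₀ x) (frame L x₀ x)).re) (trivializationAt ℂ L x₀).baseSet

/-- The coefficients at `x`, in the coordinates of the preferred chart at `x`, of the first Chern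
form `c₁(L, h) = -(i / 2π) ∂∂̄ log |e|²_h = i ∑ a_{jk̄} dz_j ∧ dz̄_k`, where `e` is a local
holomorphic frame of `L`. -/
def HermitianMetric.chernCoeff (h : HermitianMetric n L) (x : X) : Matrix (Fin n) (Fin n) ℂ :=
  (-(1 / (2 * (Real.pi : ℂ)))) •
    complexHessian (fun z =>
      let y := (chartAt (Model n) x).symm z
      Real.log (h.inner y (frame L x y) (frame L x y)).re) (chartAt (Model n) x x)

/-! ### The deformed Hermitian-Yang-Mills equation -/

/-- The ratio `(ω + iα)ⁿ / ωⁿ` at `x`, for `α = c₁(L, h)`. -/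
def volumeRatio (om : KaehlerForm n X) (h : HermitianMetric n L) (x : X) : ℂ :=
  (om.coeff x + Complex.I • h.chernCoeff x).det / (om.coeff x).det

/-- The Lagrangian phase `Θ_ω(α) = ∑ arctan λ_i` at `x`, for `α = c₁(L, h)`, where the `λ_i` are the
eigenvalues, with multiplicity, of the endomorphism `ω⁻¹α`. These are real, since this endomorphism
is Hermitian with respect to `ω`. -/
def lagrangianPhase (om : KaehlerForm n X) (h : HermitianMetric n L) (x : X) : ℝ :=
  ((((om.coeff x)⁻¹ * h.chernCoeff x).charpoly.roots).map fun l => Real.arctan l.re).sum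

/-- `h` solves the deformed Hermitian-Yang-Mills equation with constant `θ`:
`Im (e^{-iθ} (ω + iα)ⁿ) = 0` and `Re (e^{-iθ} (ω + iα)ⁿ) > 0`, for `α = c₁(L, h)`. -/
def SolvesDHYM (om : KaehlerForm n X) (h : HermitianMetric n L) (θ : ℝ) : Prop :=
  ∀ x : X, (Complex.exp (-(Complex.I * θ)) * volumeRatio om h x).im = 0 ∧
    0 < (Complex.exp (-(Complex.I * θ)) * volumeRatio om h x).re

/-- `θ` is the lifted angle of the solution `h` of the deformed Hermitian-Yang-Mills equation: the
equation holds with constant `θ`, and `θ` is the real number (not only its class modulo `2π`) to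
which the Lagrangian phase of `c₁(L, h)` is identically equal. -/
def IsLiftedAngle (om : KaehlerForm n X) (h : HermitianMetric n L) (θ : ℝ) : Prop :=
  SolvesDHYM om h θ ∧ ∀ x : X, lagrangianPhase om h x = θ

variable (L) in
/-- `L` admits a solution of the deformed Hermitian-Yang-Mills equation and has slicing angle
`φ = θ - (n - 2) π / 2`, where `θ` is the lifted angle. -/
def AdmitsDHYMWithSlicingAngle (om : KaehlerForm n X) (φ : ℝ) : Prop :=
  ∃ (h : HermitianMetric n L) (θ : ℝ), IsLiftedAngle om h θ ∧ φ = θ - ((n : ℝ) - 2) * (Real.pi / 2)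

end LineBundle

end DHYM

end

/-! The proof applies the maximum principle to the pointwise norm of a bundle map `L → M`. If `σ` is
not zero, then by compactness `|σ|²` attains a positive maximum at some `x₀`. In holomorphic frames
near `x₀`, `log |σ|² = log |f|² + log h_M - log h_L` with `f` holomorphic and nonvanishing. The term
`log |f|²` is pluriharmonic, so at the maximum `i∂∂̄ log h_M ≤ i∂∂̄ log h_L`, that is `c₁(L) ≤
c₁(M)` at `x₀` (`chernCoeff_sub_posSemidef`).

The Lagrangian phase is monotone in the form: by Weyl's monotonicity
(`LinearMap.IsSymmetric.eigenvalues_le_eigenvalues`), the sorted eigenvalues relative to `ω`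
increase with the form, and `arctan` is increasing. Both phases are constant, so comparing them at
the single point `x₀` gives `θ_L ≤ θ_M`, against the order of the slicing angles. -/

noncomputable section

open scoped ComplexOrder

/-! ### Weyl monotonicity of sorted eigenvalues. -/

section EigenvalueMonotonicity

variable {𝕜 E : Type*} [RCLike 𝕜] [NormedAddCommGroup E] [InnerProductSpace 𝕜 E]

lemma OrthonormalBasis.inner_eq_zero_of_mem_span_image {ι : Type*} [Fintype ι]
    (b : OrthonormalBasis ι 𝕜 E) {s : Set ι} {v : E} (hv : v ∈ Submodule.span 𝕜 (b '' s))
    {i : ι} (hi : i ∉ s) : inner 𝕜 (b i) v = 0 := by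
  induction hv using Submodule.span_induction with
  | mem x hx =>
    obtain ⟨j, hj, rfl⟩ := hx
    exact b.orthonormal.2 (fun h => hi (h ▸ hj))
  | zero => simp
  | add x y _ _ hx hy => simp [inner_add_right, hx, hy]
  | smul c x _ hx => simp [inner_smul_right, hx]

variable [FiniteDimensional 𝕜 E] {n : ℕ}

lemma LinearMap.IsSymmetric.re_inner_apply_eq_sum {T : E →ₗ[𝕜] E} (hT : T.IsSymmetric)
    (hn : Module.finrank 𝕜 E = n) (v : E) :
    RCLike.re (inner 𝕜 v (T v)) =
      ∑ i, hT.eigenvalues hn i * ‖inner 𝕜 (hT.eigenvectorBasis hn i) v‖ ^ 2 := by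
  rw [← (hT.eigenvectorBasis hn).sum_inner_mul_inner v (T v), map_sum]
  refine Finset.sum_congr rfl fun i _ => ?_
  rw [← hT (hT.eigenvectorBasis hn i) v, hT.apply_eigenvectorBasis, inner_smul_left,
    RCLike.conj_ofReal, mul_left_comm, ← inner_conj_symm v, RCLike.conj_mul]
  norm_cast

/-- The sorted eigenvalues of symmetric operators are monotone for the order given by quadratic
forms. -/
theorem LinearMap.IsSymmetric.eigenvalues_le_eigenvalues {S T : E →ₗ[𝕜] E} (hS : S.IsSymmetric)
    (hT : T.IsSymmetric) (hn : Module.finrank 𝕜 E = n)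
    (h : ∀ v, RCLike.re (inner 𝕜 v (S v)) ≤ RCLike.re (inner 𝕜 v (T v))) (i : Fin n) :
    hS.eigenvalues hn i ≤ hT.eigenvalues hn i := by
  by_contra! hlt
  set b := hS.eigenvectorBasis hn
  set c := hT.eigenvectorBasis hn
  -- The eigenvectors `0, …, i` of `S` and `i, …, n - 1` of `T` span subspaces of dimensions `i + 1`
  -- and `n - i`. These add up to `n + 1`, so the spans share a nonzero vector.
  have hb : Module.finrank 𝕜 (Submodule.span 𝕜 (b '' Set.Iic i)) = i + 1 := by
    rw [Set.image_eq_range]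
    refine (finrank_span_eq_card
      (b.orthonormal.linearIndependent.comp _ Subtype.val_injective)).trans ?_
    rw [← Set.toFinset_card]
    simp
  have hc : Module.finrank 𝕜 (Submodule.span 𝕜 (c '' Set.Ici i)) = n - i := by
    rw [Set.image_eq_range]
    refine (finrank_span_eq_card
      (c.orthonormal.linearIndependent.comp _ Subtype.val_injective)).trans ?_
    rw [← Set.toFinset_card]
    simp
  have hdis : ¬ Disjoint (Submodule.span 𝕜 (b '' Set.Iic i)) (Submodule.span 𝕜 (c '' Set.Ici i)) :=
    fun hd => by
      have := Submodule.finrank_add_finrank_le_of_disjoint hd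
      omega
  rw [disjoint_iff, Submodule.eq_bot_iff] at hdis
  push Not at hdis
  obtain ⟨v, ⟨hvb, hvc⟩, hv⟩ := hdis
  -- Eigenvalues are sorted in decreasing order, so the `i`-th one is the smallest on the first span
  -- and, in `hup`, the largest on the second.
  have hlow : hS.eigenvalues hn i * ‖v‖ ^ 2 ≤ RCLike.re (inner 𝕜 v (S v)) := by
    rw [hS.re_inner_apply_eq_sum hn, ← b.sum_sq_norm_inner_right v, Finset.mul_sum]
    refine Finset.sum_le_sum fun j _ => ?_
    by_cases hj : j ∈ Set.Iic i
    · exact mul_le_mul_of_nonneg_right (hS.eigenvalues_antitone hn hj) (by positivity)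
    · simp [b, b.inner_eq_zero_of_mem_span_image hvb hj]
  have hup : RCLike.re (inner 𝕜 v (T v)) ≤ hT.eigenvalues hn i * ‖v‖ ^ 2 := by
    rw [hT.re_inner_apply_eq_sum hn, ← c.sum_sq_norm_inner_right v, Finset.mul_sum]
    refine Finset.sum_le_sum fun j _ => ?_
    by_cases hj : j ∈ Set.Ici i
    · exact mul_le_mul_of_nonneg_right (hT.eigenvalues_antitone hn hj) (by positivity)
    · simp [c, c.inner_eq_zero_of_mem_span_image hvc hj]
  have hv2 : 0 < ‖v‖ ^ 2 := by positivity
  nlinarith [h v]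

end EigenvalueMonotonicity

/-! ### Eigenvalues of a Hermitian form relative to a positive definite one. -/

namespace Matrix

variable {m : Type*} [Fintype m] [DecidableEq m]

lemma IsHermitian.eigenvalues₀_le_eigenvalues₀ {A B : Matrix m m ℂ} (hA : A.IsHermitian)
    (hB : B.IsHermitian) (h : (B - A).PosSemidef) (i : Fin (Fintype.card m)) :
    hA.eigenvalues₀ i ≤ hB.eigenvalues₀ i := by
  refine LinearMap.IsSymmetric.eigenvalues_le_eigenvalues _ _ _ (fun v => ?_) i
  have key := (Complex.le_def.1 (h.dotProduct_mulVec_nonneg v.ofLp)).1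
  rw [sub_mulVec, dotProduct_sub, Complex.sub_re, Complex.zero_re, sub_nonneg] at key
  simpa [EuclideanSpace.inner_eq_star_dotProduct, dotProduct_comm] using key

lemma IsHermitian.sum_roots_charpoly_le {f : ℝ → ℝ} (hf : Monotone f) {A B : Matrix m m ℂ}
    (hA : A.IsHermitian) (hB : B.IsHermitian) (h : (B - A).PosSemidef) :
    (A.charpoly.roots.map fun l => f l.re).sum ≤ (B.charpoly.roots.map fun l => f l.re).sum := by
  rw [hA.roots_charpoly_eq_eigenvalues₀, hB.roots_charpoly_eq_eigenvalues₀, Multiset.map_map,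
    Multiset.map_map]
  exact Finset.sum_le_sum fun i _ => by
    simpa using hf (hA.eigenvalues₀_le_eigenvalues₀ hB h i)

/-- If `A` is positive definite, then `A⁻¹ B` has the characteristic polynomial of a Hermitian
matrix which is congruent to `B`. -/
lemma PosDef.exists_charpoly_inv_mul {A : Matrix m m ℂ} (hA : A.PosDef) :
    ∃ D : Matrix m m ℂ, ∀ B : Matrix m m ℂ, (A⁻¹ * B).charpoly = (Dᴴ * B * D).charpoly := by
  open scoped MatrixOrder in
  obtain ⟨D, hD⟩ := CStarAlgebra.nonneg_iff_eq_star_mul_self.mp hA.inv.posSemidef.nonneg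
  -- Here `A⁻¹ = Dᴴ D`, and `Dᴴ (D B)` has the same characteristic polynomial as `(D B) Dᴴ`.
  refine ⟨Dᴴ, fun B => ?_⟩
  rw [hD, star_eq_conjTranspose, conjTranspose_conjTranspose, mul_assoc, charpoly_mul_comm]

/-- One congruence `D` serves both `B` and `C`, and congruence preserves the semidefiniteness of `C
- B`; this reduces to the Hermitian case. -/
lemma PosDef.sum_roots_charpoly_inv_mul_le {f : ℝ → ℝ} (hf : Monotone f) {A B C : Matrix m m ℂ}
    (hA : A.PosDef) (hB : B.IsHermitian) (hC : C.IsHermitian) (h : (C - B).PosSemidef) :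
    ((A⁻¹ * B).charpoly.roots.map fun l => f l.re).sum ≤
      ((A⁻¹ * C).charpoly.roots.map fun l => f l.re).sum := by
  obtain ⟨D, hD⟩ := hA.exists_charpoly_inv_mul
  rw [hD, hD]
  refine IsHermitian.sum_roots_charpoly_le hf (isHermitian_conjTranspose_mul_mul D hB)
    (isHermitian_conjTranspose_mul_mul D hC) ?_
  simpa [mul_sub, sub_mul] using h.conjTranspose_mul_mul_same D

end Matrix

/-! ### Levi forms of real bilinear forms on `ℂⁿ`. -/

namespace DHYM

variable {n : ℕ}

/-- The sesquilinear form `∑ S_{jk̄} v_j w̄_k` associated with a real bilinear form `S`, such that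
the diagonal value at `v` is `(S(v, v) + S(iv, iv)) / 4` when `S` is symmetric. -/
def leviForm (S : Model n →ₗ[ℝ] Model n →ₗ[ℝ] ℝ) : Model n →ₗ[ℂ] Model n →ₗ⋆[ℂ] ℂ :=
  LinearMap.mk₂'ₛₗ (RingHom.id ℂ) (starRingEnd ℂ)
    (fun v w => ((S v w + S (Complex.I • v) (Complex.I • w) : ℝ) +
      Complex.I * (S v (Complex.I • w) - S (Complex.I • v) w : ℝ)) / 4)
    (fun v₁ v₂ w => by simp only [smul_add, map_add, LinearMap.add_apply]; push_cast; ring)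
    (fun c v w => by
      have h1 : c • v = c.re • v + c.im • (Complex.I • v) := by
        rw [← Complex.coe_smul, ← Complex.coe_smul, smul_smul, ← add_smul, Complex.re_add_im]
      have h2 : Complex.I • (c • v) = c.re • (Complex.I • v) - c.im • v := by
        rw [h1, smul_add, smul_comm _ c.re, smul_comm _ c.im, smul_smul, Complex.I_mul_I]
        simp [sub_eq_add_neg]
      rw [h2, h1]
      simp only [map_add, map_sub, map_smul, LinearMap.add_apply, LinearMap.sub_apply,
        LinearMap.smul_apply, smul_eq_mul, RingHom.id_apply]
      conv_rhs => rw [← Complex.re_add_im c]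
      push_cast
      linear_combination (-(c.im : ℂ)) * (S v (Complex.I • w) - S (Complex.I • v) w) / 4 *
        Complex.I_sq)
    (fun v w₁ w₂ => by simp only [smul_add, map_add]; push_cast; ring)
    (fun c v w => by
      have h1 : c • w = c.re • w + c.im • (Complex.I • w) := by
        rw [← Complex.coe_smul, ← Complex.coe_smul, smul_smul, ← add_smul, Complex.re_add_im]
      have h2 : Complex.I • (c • w) = c.re • (Complex.I • w) - c.im • w := by
        rw [h1, smul_add, smul_comm _ c.re, smul_comm _ c.im, smul_smul, Complex.I_mul_I]
        simp [sub_eq_add_neg]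
      have h3 : (starRingEnd ℂ) c = c.re - c.im * Complex.I := by
        apply Complex.ext <;> simp
      rw [h2, h1, h3]
      simp only [map_add, map_sub, map_smul, smul_eq_mul]
      push_cast
      linear_combination (c.im : ℂ) * (S v (Complex.I • w) - S (Complex.I • v) w) / 4 *
        Complex.I_sq)

lemma leviForm_apply (S : Model n →ₗ[ℝ] Model n →ₗ[ℝ] ℝ) (v w : Model n) :
    leviForm S v w = ((S v w + S (Complex.I • v) (Complex.I • w) : ℝ) +
      Complex.I * (S v (Complex.I • w) - S (Complex.I • v) w : ℝ)) / 4 := rfl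

/-- The matrix of `leviForm S` in the coordinates of `ℂⁿ`. -/
def leviMatrix (S : Model n →ₗ[ℝ] Model n →ₗ[ℝ] ℝ) : Matrix (Fin n) (Fin n) ℂ :=
  Matrix.of fun j k => leviForm S (coordVec j) (coordVec k)

lemma leviMatrix_sub (S T : Model n →ₗ[ℝ] Model n →ₗ[ℝ] ℝ) :
    leviMatrix (S - T) = leviMatrix S - leviMatrix T := by
  ext j k
  simp only [leviMatrix, leviForm_apply, Matrix.of_apply, Matrix.sub_apply, LinearMap.sub_apply]
  push_cast
  ring

variable {S : Model n →ₗ[ℝ] Model n →ₗ[ℝ] ℝ}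

lemma leviForm_self (hS : ∀ v w, S v w = S w v) (v : Model n) :
    leviForm S v v = ((S v v + S (Complex.I • v) (Complex.I • v)) / 4 : ℝ) := by
  rw [leviForm_apply, hS v (Complex.I • v)]
  push_cast
  ring

lemma leviMatrix_isHermitian (hS : ∀ v w, S v w = S w v) : (leviMatrix S).IsHermitian := by
  ext j k
  simp only [leviMatrix, leviForm_apply, Matrix.conjTranspose_apply, Matrix.of_apply]
  rw [hS (coordVec k) (coordVec j), hS (coordVec k) (Complex.I • coordVec j),
    hS (Complex.I • coordVec k) (coordVec j), hS (Complex.I • coordVec k)]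
  simp [-map_sub, -map_add]
  ring

/-- The row index of `leviMatrix` is the linear slot and the column index the conjugate-linear one,
so the vector that appears is the conjugate of `c`. -/
lemma star_dotProduct_leviMatrix (hS : ∀ v w, S v w = S w v) (c : Fin n → ℂ) :
    star c ⬝ᵥ leviMatrix S *ᵥ c =
      ((S (WithLp.toLp 2 (star c)) (WithLp.toLp 2 (star c)) +
        S (Complex.I • WithLp.toLp 2 (star c)) (Complex.I • WithLp.toLp 2 (star c))) / 4 : ℝ) := by
  rw [← leviForm_self hS]
  have hv : WithLp.toLp 2 (star c) = ∑ j, (star c) j • (coordVec j : Model n) := by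
    ext k
    simp [coordVec, Finset.sum_apply, Pi.single_apply]
  rw [hv]
  simp only [map_sum, LinearMap.sum_apply, map_smulₛₗ, LinearMap.smul_apply, dotProduct,
    Matrix.mulVec, leviMatrix, Matrix.of_apply, Finset.mul_sum, smul_eq_mul, RingHom.id_apply,
    Pi.star_apply, RCLike.star_def, Complex.conj_conj]
  rw [Finset.sum_comm]
  exact Finset.sum_congr rfl fun j _ => Finset.sum_congr rfl fun k _ => by ring

lemma leviMatrix_posSemidef (hS : ∀ v w, S v w = S w v)
    (h : ∀ v, 0 ≤ S v v + S (Complex.I • v) (Complex.I • v)) : (leviMatrix S).PosSemidef := by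
  refine .of_dotProduct_mulVec_nonneg (leviMatrix_isHermitian hS) fun c => ?_
  rw [star_dotProduct_leviMatrix hS]
  exact Complex.zero_le_real.2 (by linarith [h (WithLp.toLp 2 (star c))])

lemma leviMatrix_posDef (hS : ∀ v w, S v w = S w v)
    (h : ∀ v, v ≠ 0 → 0 < S v v + S (Complex.I • v) (Complex.I • v)) : (leviMatrix S).PosDef := by
  refine .of_dotProduct_mulVec_pos (leviMatrix_isHermitian hS) fun c hc => ?_
  rw [star_dotProduct_leviMatrix hS]
  refine Complex.zero_lt_real.2 (div_pos (h _ fun h0 => hc ?_) four_pos)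
  have := congrArg WithLp.ofLp h0
  simpa using this

/-! ### Positivity of the Kähler coefficients. -/

section Kaehler

variable {X : Type*} [TopologicalSpace X] [ChartedSpace (Model n) X]

/-- The coefficients are the Levi matrix of the Riemannian metric `S(v, w) = η(v, iw)`. Type `(1,1)`
makes `S` symmetric and gives `S(v, v) + S(iv, iv) = 2 η(v, iv)`. -/
lemma KaehlerForm.coeff_posDef (η : KaehlerForm n X) (x : X) : (η.coeff x).PosDef := by
  let a : Model n [⋀^Fin 2]→L[ℝ] ℝ := η.form x
  have h11 : ∀ v w : Model n, a ![Complex.I • v, Complex.I • w] = a ![v, w] := η.type_one_one x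
  have hpos : ∀ v : Model n, v ≠ 0 → 0 < a ![v, Complex.I • v] := η.pos x
  have hII : ∀ v : Model n, Complex.I • Complex.I • v = -v := fun v => by
    rw [smul_smul, Complex.I_mul_I, neg_one_smul]
  have hswap : ∀ v w : Model n, a ![v, w] = - a ![w, v] := fun v w => by
    have := a.toAlternatingMap.map_swap ![w, v] (i := 0) (j := 1) (by decide)
    rw [show ![w, v] ∘ ⇑(Equiv.swap (0 : Fin 2) 1) = ![v, w] by
      ext i; fin_cases i <;> simp] at this
    exact this
  have hup : ∀ v w x : Model n, Function.update ![v, w] 0 x = ![x, w] := fun v w x => by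
    ext i; fin_cases i <;> simp
  have hadd1 : ∀ v v' w : Model n, a ![v + v', w] = a ![v, w] + a ![v', w] := fun v v' w => by
    have := a.toAlternatingMap.map_update_add ![v, w] 0 v v'
    rw [hup, hup, hup] at this
    exact this
  have hsmul1 : ∀ (c : ℝ) (v w : Model n), a ![c • v, w] = c * a ![v, w] := fun c v w => by
    have := a.toAlternatingMap.map_update_smul ![v, w] 0 c v
    rw [hup, hup] at this
    exact this
  have hadd2 : ∀ v w w' : Model n, a ![v, w + w'] = a ![v, w] + a ![v, w'] := fun v w w' => by
    rw [hswap, hadd1, hswap w, hswap w']; ring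
  have hsmul2 : ∀ (c : ℝ) (v w : Model n), a ![v, c • w] = c * a ![v, w] := fun c v w => by
    rw [hswap, hsmul1, hswap w]; ring
  let S : Model n →ₗ[ℝ] Model n →ₗ[ℝ] ℝ := LinearMap.mk₂ ℝ (fun v w => a ![v, Complex.I • w])
    (fun v v' w => hadd1 _ _ _) (fun c v w => hsmul1 _ _ _)
    (fun v w w' => by rw [smul_add, hadd2]) (fun c v w => by rw [smul_comm, hsmul2]; rfl)
  have hSa : ∀ v w, S v w = a ![v, Complex.I • w] := fun _ _ => rfl
  have hneg : ∀ v w : Model n, a ![v, -w] = - a ![v, w] := fun v w => by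
    simpa using hsmul2 (-1) v w
  have hS : ∀ v w, S v w = S w v := fun v w => by
    rw [hSa, hSa, hswap w, ← h11 v, hII, hneg]
  have hcoeff : η.coeff x = leviMatrix S := by
    ext j k
    change ((a ![coordVec j, Complex.I • coordVec k] : ℂ)
      - Complex.I * (a ![coordVec j, coordVec k] : ℂ)) / 2 = leviForm S (coordVec j) (coordVec k)
    rw [leviForm_apply]
    have h2 : a ![Complex.I • coordVec j, Complex.I • coordVec k] = a ![coordVec j, coordVec k] :=
      h11 _ _
    have h3 : a ![Complex.I • coordVec j, coordVec k] = -a ![coordVec j, Complex.I • coordVec k] := by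
      rw [← h11, hII, hswap, hneg, ← hswap]
    simp only [hSa, hII, hneg, h2, h3]
    push_cast
    ring
  rw [hcoeff]
  refine leviMatrix_posDef hS fun v hv => ?_
  have h1 := hpos v hv
  rw [hSa, hSa, h11]
  linarith

end Kaehler

/-! ### Second derivatives and the local maximum principle. -/

/-- The second derivative of a real function, as a bilinear map. -/
def secondDeriv (u : Model n → ℝ) (z : Model n) : Model n →ₗ[ℝ] Model n →ₗ[ℝ] ℝ :=
  LinearMap.mk₂ ℝ (fun v w => fderiv ℝ (fderiv ℝ u) z v w) (by simp) (by simp) (by simp) (by simp)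

lemma secondDeriv_apply (u : Model n → ℝ) (z v w : Model n) :
    secondDeriv u z v w = fderiv ℝ (fderiv ℝ u) z v w := rfl

section

variable {u u' : Model n → ℝ} {z : Model n}

lemma secondDeriv_symm (hu : ContDiffAt ℝ 2 u z) (v w : Model n) :
    secondDeriv u z v w = secondDeriv u z w v :=
  hu.isSymmSndFDerivAt (by simp) v w

lemma differentiableAt_fderiv (hu : ContDiffAt ℝ 2 u z) : DifferentiableAt ℝ (fderiv ℝ u) z :=
  (hu.fderiv_right (m := 1) (by norm_num)).differentiableAt (by norm_num)

lemma eventually_differentiableAt (hu : ContDiffAt ℝ 2 u z) :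
    ∀ᶠ y in nhds z, DifferentiableAt ℝ u y :=
  (hu.eventually (by simp)).mono fun _ hy => hy.differentiableAt (by norm_num)

lemma secondDeriv_add (hu : ContDiffAt ℝ 2 u z) (hu' : ContDiffAt ℝ 2 u' z) :
    secondDeriv (fun y => u y + u' y) z = secondDeriv u z + secondDeriv u' z := by
  ext v w
  have h : fderiv ℝ (fun y => u y + u' y) =ᶠ[nhds z] fun y => fderiv ℝ u y + fderiv ℝ u' y := by
    filter_upwards [eventually_differentiableAt hu, eventually_differentiableAt hu'] with y h1 h2
    exact fderiv_fun_add h1 h2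
  rw [secondDeriv_apply, h.fderiv_eq,
    fderiv_fun_add (differentiableAt_fderiv hu) (differentiableAt_fderiv hu')]
  rfl

lemma secondDeriv_sub (hu : ContDiffAt ℝ 2 u z) (hu' : ContDiffAt ℝ 2 u' z) :
    secondDeriv (fun y => u y - u' y) z = secondDeriv u z - secondDeriv u' z := by
  ext v w
  have h : fderiv ℝ (fun y => u y - u' y) =ᶠ[nhds z] fun y => fderiv ℝ u y - fderiv ℝ u' y := by
    filter_upwards [eventually_differentiableAt hu, eventually_differentiableAt hu'] with y h1 h2
    exact fderiv_fun_sub h1 h2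
  rw [secondDeriv_apply, h.fderiv_eq,
    fderiv_fun_sub (differentiableAt_fderiv hu) (differentiableAt_fderiv hu')]
  rfl

/-- The second derivative of a function is nonpositive at a local maximum. -/
lemma secondDeriv_nonpos_of_isLocalMax (hu : ContDiffAt ℝ 2 u z) (hmax : IsLocalMax u z)
    (v : Model n) : secondDeriv u z v v ≤ 0 := by
  have hline : ∀ t : ℝ, HasDerivAt (fun t : ℝ => z + t • v) v t := fun t => by
    simpa using ((hasDerivAt_id t).smul_const v).const_add z
  have hcont : Filter.Tendsto (fun t : ℝ => z + t • v) (nhds 0) (nhds z) := by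
    simpa using (hline 0).continuousAt.tendsto
  let g : ℝ → ℝ := fun t => u (z + t • v)
  have hg' : deriv g =ᶠ[nhds 0] fun t => fderiv ℝ u (z + t • v) v := by
    filter_upwards [hcont.eventually (eventually_differentiableAt hu)] with t ht
    exact (ht.hasFDerivAt.comp_hasDerivAt t (hline t)).deriv
  have hg'' : deriv (deriv g) 0 = secondDeriv u z v v := by
    rw [hg'.deriv_eq]
    have h0 : HasFDerivAt (fderiv ℝ u) (fderiv ℝ (fderiv ℝ u) z) (z + (0 : ℝ) • v) := by
      simpa using (differentiableAt_fderiv hu).hasFDerivAt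
    have h1 := h0.comp_hasDerivAt (0 : ℝ) (hline 0)
    simpa [secondDeriv_apply] using (h1.clm_apply (hasDerivAt_const (0 : ℝ) v)).deriv
  have hgmax : IsLocalMax g 0 := by
    have := hcont.eventually hmax
    filter_upwards [this] with t ht
    simpa [g] using ht
  by_contra! hpos
  have hgcont : ContinuousAt g 0 := by
    have h0 : ContinuousAt u (z + (0 : ℝ) • v) := by simpa using hu.continuousAt
    exact ContinuousAt.comp (f := fun t : ℝ => z + t • v) h0 (hline 0).continuousAt
  -- A positive second derivative would make `0` a local minimum of `g` as well, so `g` would be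
  -- locally constant.
  have hgmin := isLocalMin_of_deriv_deriv_pos (hg''.symm ▸ hpos) hgmax.deriv_eq_zero hgcont
  have hconst : g =ᶠ[nhds 0] fun _ => g 0 := by
    filter_upwards [hgmax, hgmin] with t h1 h2 using le_antisymm h1 h2
  have : deriv (deriv g) 0 = 0 := by
    rw [hconst.deriv.deriv_eq]
    simp
  linarith

/-- The real part of a holomorphic function is pluriharmonic. -/
lemma secondDeriv_re_add_eq_zero {G : Model n → ℂ} (hG : ContDiffAt ℂ 2 G z) (v : Model n) :
    secondDeriv (fun y => (G y).re) z v v +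
      secondDeriv (fun y => (G y).re) z (Complex.I • v) (Complex.I • v) = 0 := by
  have h1 : ∀ᶠ y in nhds z, DifferentiableAt ℂ G y :=
    (hG.eventually (by simp)).mono fun _ hy => hy.differentiableAt (by norm_num)
  have h2 : DifferentiableAt ℂ (fderiv ℂ G) z :=
    (hG.fderiv_right (m := 1) (by norm_num)).differentiableAt (by norm_num)
  -- The complex second derivative is `ℂ`-bilinear, so replacing `v` by `iv` changes the sign of its
  -- diagonal value.
  have key : ∀ w : Model n, secondDeriv (fun y => (G y).re) z w w =
      (fderiv ℂ (fderiv ℂ G) z w w).re := fun w => by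
    have hd : ∀ᶠ y in nhds z, fderiv ℝ (fun y => (G y).re) y =
        Complex.reCLM.comp ((fderiv ℂ G y).restrictScalars ℝ) := by
      filter_upwards [h1] with y hy
      exact (Complex.reCLM.hasFDerivAt.comp y (hy.hasFDerivAt.restrictScalars ℝ)).fderiv
    have hcomp : HasFDerivAt (fun y => fderiv ℝ (fun y => (G y).re) y w)
        (Complex.reCLM.comp (((ContinuousLinearMap.apply ℂ ℂ w).comp
          (fderiv ℂ (fderiv ℂ G) z)).restrictScalars ℝ)) z := by
      have h3 : HasFDerivAt (fun y => fderiv ℂ G y w) ((ContinuousLinearMap.apply ℂ ℂ w).comp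
          (fderiv ℂ (fderiv ℂ G) z)) z :=
        (ContinuousLinearMap.apply ℂ ℂ w).hasFDerivAt.comp z h2.hasFDerivAt
      refine (Complex.reCLM.hasFDerivAt.comp z (h3.restrictScalars ℝ)).congr_of_eventuallyEq ?_
      filter_upwards [hd] with y hy
      rw [hy]
      rfl
    have hdiff : DifferentiableAt ℝ (fderiv ℝ (fun y => (G y).re)) z :=
      differentiableAt_fderiv
        (Complex.reCLM.contDiff.contDiffAt.comp z (hG.restrict_scalars ℝ))
    have h4 : HasFDerivAt (fun y => fderiv ℝ (fun y => (G y).re) y w)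
        ((ContinuousLinearMap.apply ℝ ℝ w).comp
          (fderiv ℝ (fderiv ℝ (fun y => (G y).re)) z)) z :=
      (ContinuousLinearMap.apply ℝ ℝ w).hasFDerivAt.comp z hdiff.hasFDerivAt
    have h5 := congrArg (fun T => T w) (h4.unique hcomp)
    exact h5
  rw [key, key]
  simp only [map_smul, _root_.smul_apply, smul_eq_mul, ← mul_assoc, Complex.I_mul_I]
  simp

/-- Passes from Wirtinger derivatives to a coordinate-free form, where positivity can be tested on
the pairs `v`, `iv`. -/
lemma complexHessian_eq_leviMatrix (hu : ContDiffAt ℝ 2 u z) :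
    complexHessian u z = leviMatrix (secondDeriv u z) := by
  ext j k
  have hd : ∀ e : Model n, ∀ᶠ y in nhds z, fderiv ℝ (fun w => (u w : ℂ)) y e = fderiv ℝ u y e :=
    fun e => by
      filter_upwards [eventually_differentiableAt hu] with y hy
      have h1 : HasFDerivAt (fun w => (u w : ℂ)) (Complex.ofRealCLM.comp (fderiv ℝ u y)) y :=
        Complex.ofRealCLM.hasFDerivAt.comp y hy.hasFDerivAt
      rw [h1.fderiv]
      rfl
  have h2 : ∀ e : Model n, HasFDerivAt (fun y => ((fderiv ℝ u y e : ℝ) : ℂ))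
      (Complex.ofRealCLM.comp ((ContinuousLinearMap.apply ℝ ℝ e).comp
        (fderiv ℝ (fderiv ℝ u) z))) z := fun e =>
    Complex.ofRealCLM.hasFDerivAt.comp z ((ContinuousLinearMap.apply ℝ ℝ e).hasFDerivAt.comp z
      (differentiableAt_fderiv hu).hasFDerivAt)
  have hw : HasFDerivAt (wirtingerBar k fun w => (u w : ℂ)) _ z :=
    (((h2 (coordVec k)).add ((h2 (Complex.I • coordVec k)).const_mul Complex.I)).mul_const
      (2⁻¹ : ℂ)).congr_of_eventuallyEq (by
        filter_upwards [hd (coordVec k), hd (Complex.I • coordVec k)] with y h3 h4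
        simp [wirtingerBar, h3, h4, div_eq_mul_inv])
  have hw' : ∀ e : Model n, fderiv ℝ (wirtingerBar k fun w => (u w : ℂ)) z e =
      (2⁻¹ : ℂ) * ((fderiv ℝ (fderiv ℝ u) z e (coordVec k) : ℂ) +
        Complex.I * (fderiv ℝ (fderiv ℝ u) z e (Complex.I • coordVec k) : ℂ)) := fun e => by
    rw [hw.fderiv]
    rfl
  simp only [complexHessian, Matrix.of_apply, leviMatrix, leviForm_apply, wirtinger, hw',
    secondDeriv_apply]
  push_cast
  linear_combination (-(1 / 4 : ℂ)) * (fderiv ℝ (fderiv ℝ u) z (Complex.I • coordVec j)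
    (Complex.I • coordVec k)) * Complex.I_sq

/-- Maximum principle: if `u' - u + log |f|²` has a local maximum at `z`, where `f` is holomorphic
and does not vanish, then `i∂∂̄u' ≤ i∂∂̄u` at `z`. -/
lemma complexHessian_sub_posSemidef (hu : ContDiffAt ℝ 2 u z) (hu' : ContDiffAt ℝ 2 u' z)
    {f : Model n → ℂ} (hf : ContDiffAt ℂ 2 f z) (hfz : f z ≠ 0)
    (hmax : IsLocalMax (fun y => u' y - u y + Real.log (‖f y‖ ^ 2)) z) :
    (complexHessian u z - complexHessian u' z).PosSemidef := by
  -- Dividing by `f z` brings the argument to `1` at `z`, where the principal logarithm is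
  -- holomorphic. Then `Re G` is `log |f|²` up to a constant.
  let G : Model n → ℂ := fun y => 2 * Complex.log (f y / f z)
  have hG : ContDiffAt ℂ 2 G z := by
    refine contDiffAt_const.mul ((Complex.contDiffAt_log ?_).comp z (hf.div_const _))
    rw [div_self hfz]
    exact Complex.one_mem_slitPlane
  have hGre : ContDiffAt ℝ 2 (fun y => (G y).re) z :=
    Complex.reCLM.contDiff.contDiffAt.comp z (hG.restrict_scalars ℝ)
  have hlog : ∀ᶠ y in nhds z, Real.log (‖f y‖ ^ 2) = (G y).re + Real.log (‖f z‖ ^ 2) := by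
    filter_upwards [hf.continuousAt.eventually_ne hfz] with y hy
    have h1 : ‖f y‖ ≠ 0 := norm_ne_zero_iff.2 hy
    have h2 : ‖f z‖ ≠ 0 := norm_ne_zero_iff.2 hfz
    simp only [G, Complex.mul_re, Complex.re_ofNat, Complex.im_ofNat, zero_mul, sub_zero,
      Complex.log_re, norm_div, Real.log_pow,
      Real.log_div h1 h2]
    push_cast
    ring
  have hmax' : IsLocalMax (fun y => u' y - u y + (G y).re) z := by
    filter_upwards [hmax, hlog] with y h1 h2
    have h3 := hlog.self_of_nhds
    linarith
  rw [complexHessian_eq_leviMatrix hu, complexHessian_eq_leviMatrix hu', ← leviMatrix_sub]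
  refine leviMatrix_posSemidef (fun v w => ?_) fun v => ?_
  · simp [secondDeriv_symm hu v w, secondDeriv_symm hu' v w]
  -- Adding the inequalities for `v` and `iv` cancels the contribution of `G`.
  · have hle := fun v => secondDeriv_nonpos_of_isLocalMax ((hu'.sub hu).add hGre) hmax' v
    rw [secondDeriv_add (hu'.sub hu) hGre, secondDeriv_sub hu' hu] at hle
    have h1 := hle v
    have h2 := hle (Complex.I • v)
    have h3 := secondDeriv_re_add_eq_zero hG v
    simp only [LinearMap.add_apply, LinearMap.sub_apply] at h1 h2 ⊢
    linarith

end

end DHYM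

/-! ### Frames and Hermitian metrics of line bundles. -/

namespace DHYM

variable {n : ℕ} {X : Type*} [TopologicalSpace X] [ChartedSpace (Model n) X]

section Frame

variable {L : X → Type*} [TopologicalSpace (Bundle.TotalSpace ℂ L)]
  [∀ x, TopologicalSpace (L x)] [∀ x, AddCommGroup (L x)] [∀ x, Module ℂ (L x)]
  [FiberBundle ℂ L] [VectorBundle ℂ ℂ L] {x₀ x : X}

lemma smul_frame (hx : x ∈ (trivializationAt ℂ L x₀).baseSet) (c : ℂ) :
    c • frame L x₀ x = (trivializationAt ℂ L x₀).symm x c := by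
  have h := ((trivializationAt ℂ L x₀).symmₗ ℂ x).map_smul c 1
  rw [Bundle.Trivialization.symmₗ_apply _ hx, Bundle.Trivialization.symmₗ_apply _ hx, smul_eq_mul,
    mul_one] at h
  exact h.symm

lemma smul_frame_continuousLinearMapAt (hx : x ∈ (trivializationAt ℂ L x₀).baseSet) (v : L x) :
    (trivializationAt ℂ L x₀).continuousLinearMapAt ℂ x v • frame L x₀ x = v := by
  rw [smul_frame hx, ← Bundle.Trivialization.symmL_apply (R := ℂ) _ hx,
    Bundle.Trivialization.symmL_continuousLinearMapAt _ hx]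

lemma frame_ne_zero (hx : x ∈ (trivializationAt ℂ L x₀).baseSet) : frame L x₀ x ≠ 0 := fun h => by
  have h1 :=
    Bundle.Trivialization.continuousLinearMapAt_symmL (R := ℂ) (trivializationAt ℂ L x₀) hx 1
  rw [Bundle.Trivialization.symmL_apply _ hx] at h1
  change (trivializationAt ℂ L x₀).continuousLinearMapAt ℂ x (frame L x₀ x) = 1 at h1
  simp [h] at h1

lemma exists_smul_eq {v w : L x} (hv : v ≠ 0) : ∃ c : ℂ, w = c • v := by
  have hx := FiberBundle.mem_baseSet_trivializationAt' (F := ℂ) (E := L) x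
  have h1 := smul_frame_continuousLinearMapAt hx v
  have h2 := smul_frame_continuousLinearMapAt hx w
  set a := (trivializationAt ℂ L x).continuousLinearMapAt ℂ x v
  have ha : a ≠ 0 := fun h => hv (by rw [← h1, h, zero_smul])
  refine ⟨(trivializationAt ℂ L x).continuousLinearMapAt ℂ x w * a⁻¹, ?_⟩
  rw [← h1, smul_smul, inv_mul_cancel_right₀ ha, h2]

end Frame

section Metric

variable {L : X → Type*} [TopologicalSpace (Bundle.TotalSpace ℂ L)]
  [∀ x, TopologicalSpace (L x)] [∀ x, AddCommGroup (L x)] [∀ x, Module ℂ (L x)]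
  [FiberBundle ℂ L]

/-- The squared length of the local frame of `L` around `x₀`. -/
def HermitianMetric.frameNormSq (h : HermitianMetric n L) (x₀ x : X) : ℝ :=
  (h.inner x (frame L x₀ x) (frame L x₀ x)).re

lemma HermitianMetric.re_inner_smul (h : HermitianMetric n L) (x : X) (c : ℂ) (v : L x) :
    (h.inner x (c • v) (c • v)).re = ‖c‖ ^ 2 * (h.inner x v v).re := by
  rw [LinearMap.map_smulₛₗ₂, map_smul, smul_eq_mul, smul_eq_mul, ← mul_assoc,
    Complex.conj_mul', ← Complex.ofReal_pow, Complex.re_ofReal_mul]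

lemma HermitianMetric.contMDiffAt_frameNormSq (h : HermitianMetric n L) (x : X) :
    ContMDiffAt 𝓘(ℝ, Model n) 𝓘(ℝ, ℝ) ∞ (h.frameNormSq x) x :=
  (h.smooth x).contMDiffAt ((trivializationAt ℂ L x).open_baseSet.mem_nhds
    (FiberBundle.mem_baseSet_trivializationAt' x))

lemma HermitianMetric.contDiffAt_frameNormSq (h : HermitianMetric n L) (x : X) :
    ContDiffAt ℝ ∞ (fun z => h.frameNormSq x ((chartAt (Model n) x).symm z))
      (chartAt (Model n) x x) := by
  have := (contMDiffAt_iff.1 (h.contMDiffAt_frameNormSq x)).2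
  simpa [contDiffWithinAt_univ, Function.comp_def, chartAt_self_eq] using this

lemma HermitianMetric.chernCoeff_eq (h : HermitianMetric n L) (x : X) :
    h.chernCoeff x = (-(1 / (2 * (Real.pi : ℂ)))) •
      complexHessian (fun z => Real.log (h.frameNormSq x ((chartAt (Model n) x).symm z)))
        (chartAt (Model n) x x) := rfl

variable [VectorBundle ℂ ℂ L]

lemma HermitianMetric.frameNormSq_pos (h : HermitianMetric n L) {x₀ x : X}
    (hx : x ∈ (trivializationAt ℂ L x₀).baseSet) : 0 < h.frameNormSq x₀ x :=
  h.pos x _ (frame_ne_zero hx)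

lemma HermitianMetric.contDiffAt_log_frameNormSq (h : HermitianMetric n L) (x : X) :
    ContDiffAt ℝ 2 (fun z => Real.log (h.frameNormSq x ((chartAt (Model n) x).symm z)))
      (chartAt (Model n) x x) := by
  refine ((h.contDiffAt_frameNormSq x).of_le (mod_cast le_top : ((2 : ℕ∞) : WithTop ℕ∞) ≤ ∞)).log ?_
  rw [(chartAt (Model n) x).left_inv (mem_chart_source _ x)]
  exact (h.frameNormSq_pos (FiberBundle.mem_baseSet_trivializationAt' x)).ne'

lemma HermitianMetric.chernCoeff_isHermitian (h : HermitianMetric n L) (x : X) :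
    (h.chernCoeff x).IsHermitian := by
  have hu := h.contDiffAt_log_frameNormSq x
  rw [h.chernCoeff_eq, complexHessian_eq_leviMatrix hu]
  refine (leviMatrix_isHermitian (secondDeriv_symm hu)).smul ?_
  simp [IsSelfAdjoint]

end Metric

lemma eventually_mem_baseSets {X : Type*} [TopologicalSpace X] {L M : X → Type*}
    [TopologicalSpace (Bundle.TotalSpace ℂ L)] [∀ x, TopologicalSpace (L x)] [FiberBundle ℂ L]
    [TopologicalSpace (Bundle.TotalSpace ℂ M)] [∀ x, TopologicalSpace (M x)] [FiberBundle ℂ M]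
    (x₀ : X) : ∀ᶠ x in nhds x₀,
    x ∈ (trivializationAt ℂ L x₀).baseSet ∧ x ∈ (trivializationAt ℂ M x₀).baseSet :=
  ((trivializationAt ℂ L x₀).open_baseSet.eventually_mem
    (FiberBundle.mem_baseSet_trivializationAt' x₀)).and
  ((trivializationAt ℂ M x₀).open_baseSet.eventually_mem
    (FiberBundle.mem_baseSet_trivializationAt' x₀))

/-! ### The norm of a holomorphic bundle map. -/

section Hom

variable {L : X → Type*} [TopologicalSpace (Bundle.TotalSpace ℂ L)]
  [∀ x, TopologicalSpace (L x)] [∀ x, AddCommGroup (L x)] [∀ x, Module ℂ (L x)]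
  [FiberBundle ℂ L] [VectorBundle ℂ ℂ L]
  {M : X → Type*} [TopologicalSpace (Bundle.TotalSpace ℂ M)]
  [∀ x, TopologicalSpace (M x)] [∀ x, AddCommGroup (M x)] [∀ x, Module ℂ (M x)]
  [FiberBundle ℂ M]

/-- The squared pointwise norm of a bundle map. -/
def homNormSq (hL : HermitianMetric n L) (hM : HermitianMetric n M)
    (s : ∀ x, L x →L[ℂ] M x) (x : X) : ℝ :=
  (hM.inner x (s x (frame L x x)) (s x (frame L x x))).re / hL.frameNormSq x x

lemma homNormSq_pos_iff (hL : HermitianMetric n L) (hM : HermitianMetric n M)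
    (s : ∀ x, L x →L[ℂ] M x) (x : X) : 0 < homNormSq hL hM s x ↔ s x ≠ 0 := by
  have hx := FiberBundle.mem_baseSet_trivializationAt' (F := ℂ) (E := L) x
  rw [homNormSq, div_pos_iff_of_pos_right (hL.frameNormSq_pos hx)]
  refine ⟨fun h h0 => by simp [h0] at h, fun h => hM.pos x _ fun h0 => h ?_⟩
  ext v
  obtain ⟨c, rfl⟩ := exists_smul_eq (w := v) (frame_ne_zero hx)
  simp [h0]

variable [VectorBundle ℂ ℂ M]

lemma lagrangianPhase_le (om : KaehlerForm n X) (hL : HermitianMetric n L)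
    (hM : HermitianMetric n M) {x : X} (h : (hM.chernCoeff x - hL.chernCoeff x).PosSemidef) :
    lagrangianPhase om hL x ≤ lagrangianPhase om hM x :=
  (om.coeff_posDef x).sum_roots_charpoly_inv_mul_le Real.arctan_strictMono.monotone
    (hL.chernCoeff_isHermitian x) (hM.chernCoeff_isHermitian x) h

/-- The coefficient of a bundle map in the local frames around `x₀`. -/
def homCoeff (s : ∀ x, L x →L[ℂ] M x) (x₀ x : X) : ℂ :=
  ContinuousLinearMap.inCoordinates ℂ L ℂ M x₀ x x₀ x (s x) 1

lemma apply_frame (s : ∀ x, L x →L[ℂ] M x) {x₀ x : X}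
    (hx : x ∈ (trivializationAt ℂ L x₀).baseSet) (hx' : x ∈ (trivializationAt ℂ M x₀).baseSet) :
    s x (frame L x₀ x) = homCoeff s x₀ x • frame M x₀ x := by
  have h : homCoeff s x₀ x =
      (trivializationAt ℂ M x₀).continuousLinearMapAt ℂ x (s x (frame L x₀ x)) := by
    rw [homCoeff, ContinuousLinearMap.inCoordinates, ContinuousLinearMap.comp_apply,
      ContinuousLinearMap.comp_apply, Bundle.Trivialization.symmL_apply _ hx]
    rfl
  rw [h, smul_frame_continuousLinearMapAt hx']

variable (hL : HermitianMetric n L) (hM : HermitianMetric n M) (s : ∀ x, L x →L[ℂ] M x)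

/-- The definition uses a frame that changes with `x`. Two frames of a line differ by a scalar `c`,
and `|c|²` cancels in the quotient, so a fixed frame near `x₀` can be used for regularity. -/
lemma homNormSq_eq {x₀ x : X}
    (hx : x ∈ (trivializationAt ℂ L x₀).baseSet) (hx' : x ∈ (trivializationAt ℂ M x₀).baseSet) :
    homNormSq hL hM s x =
      ‖homCoeff s x₀ x‖ ^ 2 * hM.frameNormSq x₀ x / hL.frameNormSq x₀ x := by
  have hx0 := frame_ne_zero (FiberBundle.mem_baseSet_trivializationAt' (F := ℂ) (E := L) x)
  obtain ⟨c, hc⟩ := exists_smul_eq (w := frame L x x) (frame_ne_zero hx)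
  have hc0 : ‖c‖ ^ 2 ≠ 0 := by
    have : c ≠ 0 := fun h => hx0 (by rw [hc, h, zero_smul])
    positivity
  rw [homNormSq, HermitianMetric.frameNormSq, hc, map_smul, hM.re_inner_smul, hL.re_inner_smul,
    apply_frame s hx hx', hM.re_inner_smul, mul_div_mul_left _ _ hc0]
  rfl

variable [∀ x, IsTopologicalAddGroup (M x)] [∀ x, ContinuousSMul ℂ (M x)]

variable {s}

lemma contMDiffAt_homCoeff {x₀ : X}
    (hs : ContMDiffAt 𝓘(ℂ, Model n) (𝓘(ℂ, Model n).prod 𝓘(ℂ, ℂ →L[ℂ] ℂ)) ω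
      (fun x => Bundle.TotalSpace.mk' (ℂ →L[ℂ] ℂ) (E := fun x => L x →L[ℂ] M x) x (s x)) x₀) :
    ContMDiffAt 𝓘(ℂ, Model n) 𝓘(ℂ, ℂ) ω (homCoeff s x₀) x₀ :=
  ((contMDiffAt_hom_bundle _).1 hs).2.clm_apply contMDiffAt_const

lemma continuous_homNormSq
    (hs : ContMDiff 𝓘(ℂ, Model n) (𝓘(ℂ, Model n).prod 𝓘(ℂ, ℂ →L[ℂ] ℂ)) ω
      (fun x => Bundle.TotalSpace.mk' (ℂ →L[ℂ] ℂ) (E := fun x => L x →L[ℂ] M x) x (s x))) :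
    Continuous (homNormSq hL hM s) := by
  refine continuous_iff_continuousAt.2 fun x₀ => ?_
  have h1 : homNormSq hL hM s =ᶠ[nhds x₀] fun x =>
      ‖homCoeff s x₀ x‖ ^ 2 * hM.frameNormSq x₀ x / hL.frameNormSq x₀ x :=
    (eventually_mem_baseSets x₀).mono fun x hx => homNormSq_eq hL hM s hx.1 hx.2
  refine ContinuousAt.congr_of_eventuallyEq ?_ h1
  exact (((contMDiffAt_homCoeff (hs x₀)).continuousAt.norm.pow 2).mul
    (hM.contMDiffAt_frameNormSq x₀).continuousAt).div
    (hL.contMDiffAt_frameNormSq x₀).continuousAt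
    (hL.frameNormSq_pos (FiberBundle.mem_baseSet_trivializationAt' x₀)).ne'

/-- At a point where the norm of a nonzero holomorphic bundle map `L → M` is maximal,
`c₁(L) ≤ c₁(M)`. -/
lemma chernCoeff_sub_posSemidef
    (hs : ContMDiff 𝓘(ℂ, Model n) (𝓘(ℂ, Model n).prod 𝓘(ℂ, ℂ →L[ℂ] ℂ)) ω
      (fun x => Bundle.TotalSpace.mk' (ℂ →L[ℂ] ℂ) (E := fun x => L x →L[ℂ] M x) x (s x)))
    {x₀ : X} (h0 : s x₀ ≠ 0)
    (hmax : ∀ x, homNormSq hL hM s x ≤ homNormSq hL hM s x₀) :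
    (hM.chernCoeff x₀ - hL.chernCoeff x₀).PosSemidef := by
  let e := chartAt (Model n) x₀
  have he : e.symm (e x₀) = x₀ := e.left_inv (mem_chart_source _ x₀)
  have hmem := FiberBundle.mem_baseSet_trivializationAt' (F := ℂ) (E := L) x₀
  have hmem' := FiberBundle.mem_baseSet_trivializationAt' (F := ℂ) (E := M) x₀
  have hpos := (homNormSq_pos_iff hL hM s x₀).2 h0
  have hf : ContDiffAt ℂ 2 (fun z => homCoeff s x₀ (e.symm z)) (e x₀) := by
    have := (contMDiffAt_iff.1 (contMDiffAt_homCoeff (hs x₀))).2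
    refine ContDiffAt.of_le (n := ω) ?_ le_top
    simpa [contDiffWithinAt_univ, Function.comp_def, chartAt_self_eq] using this
  have hfz : homCoeff s x₀ (e.symm (e x₀)) ≠ 0 := fun h => by
    rw [he] at h
    rw [homNormSq_eq hL hM s hmem hmem', h] at hpos
    simp at hpos
  have hcont : Filter.Tendsto e.symm (nhds (e x₀)) (nhds x₀) := by
    have := e.continuousAt_symm (e.map_source (mem_chart_source _ x₀))
    rwa [ContinuousAt, he] at this
  have heq : ∀ᶠ z in nhds (e x₀), Real.log (hM.frameNormSq x₀ (e.symm z)) -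
      Real.log (hL.frameNormSq x₀ (e.symm z)) + Real.log (‖homCoeff s x₀ (e.symm z)‖ ^ 2) =
      Real.log (homNormSq hL hM s (e.symm z)) ∧ 0 < homNormSq hL hM s (e.symm z) := by
    filter_upwards [hcont.eventually (eventually_mem_baseSets (L := L) (M := M) x₀),
      hf.continuousAt.eventually_ne hfz] with z hz hz0
    have h1 := hM.frameNormSq_pos hz.2
    have h2 := hL.frameNormSq_pos hz.1
    have h3 : 0 < ‖homCoeff s x₀ (e.symm z)‖ ^ 2 := by positivity
    rw [homNormSq_eq hL hM s hz.1 hz.2, Real.log_div (by positivity) h2.ne',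
      Real.log_mul h3.ne' h1.ne']
    exact ⟨by ring, by positivity⟩
  have hlocal : IsLocalMax (fun z => Real.log (hM.frameNormSq x₀ (e.symm z)) -
      Real.log (hL.frameNormSq x₀ (e.symm z)) + Real.log (‖homCoeff s x₀ (e.symm z)‖ ^ 2))
      (e x₀) := by
    filter_upwards [heq] with z hz
    rw [hz.1, heq.self_of_nhds.1, he]
    exact Real.log_le_log hz.2 (hmax _)
  have key := complexHessian_sub_posSemidef (hL.contDiffAt_log_frameNormSq x₀)
    (hM.contDiffAt_log_frameNormSq x₀) hf hfz hlocal
  have hpi : (0 : ℂ) ≤ 1 / (2 * (Real.pi : ℂ)) := by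
    have : (0 : ℝ) ≤ 1 / (2 * Real.pi) := by positivity
    exact_mod_cast Complex.zero_le_real.2 this
  -- The factor `-1/(2π)` in the Chern form reverses the order of the two Hessians.
  rw [hM.chernCoeff_eq, hL.chernCoeff_eq, neg_smul, neg_smul, neg_sub_neg, ← smul_sub]
  exact key.smul hpi

end Hom

end DHYM

end

/-! ### Comparison of the phases at a maximum point. -/

theorem mainTheorem11 {n : ℕ} {X : Type*} [TopologicalSpace X] [T2Space X] [CompactSpace X]
    [ChartedSpace (DHYM.Model n) X] [IsManifold 𝓘(ℂ, DHYM.Model n) ω X]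
    (om : DHYM.KaehlerForm n X)
    (L : X → Type*) [TopologicalSpace (Bundle.TotalSpace ℂ L)]
    [∀ x, TopologicalSpace (L x)] [∀ x, AddCommGroup (L x)] [∀ x, Module ℂ (L x)]
    [FiberBundle ℂ L] [VectorBundle ℂ ℂ L]
    [ContMDiffVectorBundle ω ℂ L 𝓘(ℂ, DHYM.Model n)]
    (M : X → Type*) [TopologicalSpace (Bundle.TotalSpace ℂ M)]
    [∀ x, TopologicalSpace (M x)] [∀ x, AddCommGroup (M x)] [∀ x, Module ℂ (M x)]
    [∀ x, IsTopologicalAddGroup (M x)] [∀ x, ContinuousSMul ℂ (M x)]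
    [FiberBundle ℂ M] [VectorBundle ℂ ℂ M]
    [ContMDiffVectorBundle ω ℂ M 𝓘(ℂ, DHYM.Model n)]
    (φL φM : ℝ)
    (hL : DHYM.AdmitsDHYMWithSlicingAngle L om φL)
    (hM : DHYM.AdmitsDHYMWithSlicingAngle M om φM)
    (hpos : 0 < φM) (hlt : φM < φL) (hpi : φL < Real.pi)
    (σ : Cₛ^ω⟮𝓘(ℂ, DHYM.Model n); ℂ →L[ℂ] ℂ, fun x => L x →L[ℂ] M x⟯) :
    σ = 0 := by
  obtain ⟨hL, θL, ⟨-, hθL⟩, rfl⟩ := hL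
  obtain ⟨hM, θM, ⟨-, hθM⟩, rfl⟩ := hM
  by_contra hσ
  obtain ⟨x, hx⟩ : ∃ x, σ x ≠ 0 := by
    by_contra! h
    exact hσ (ContMDiffSection.ext h)
  have : Nonempty X := ⟨x⟩
  obtain ⟨x₀, -, hmax⟩ := isCompact_univ.exists_isMaxOn Set.univ_nonempty
    (DHYM.continuous_homNormSq hL hM σ.contMDiff).continuousOn
  have hmax' : ∀ y, DHYM.homNormSq hL hM σ y ≤ DHYM.homNormSq hL hM σ x₀ :=
    fun y => hmax (Set.mem_univ y)
  have h0 : σ x₀ ≠ 0 := (DHYM.homNormSq_pos_iff hL hM σ x₀).1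
    (((DHYM.homNormSq_pos_iff hL hM σ x).2 hx).trans_le (hmax' x))
  have hle := DHYM.lagrangianPhase_le om hL hM
    (DHYM.chernCoeff_sub_posSemidef hL hM σ.contMDiff h0 hmax')
  -- Both slicing angles subtract the same multiple of `π / 2`, so `θL ≤ θM` contradicts `hlt`.
  rw [hθL, hθM] at hle
  linarith
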